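/- Call a bounded measurable set $\Omega\subset\mathbb{R}^d$ of positive Lebesgue measure *spectral* if there is a countable set $\Lambda\subset\mathbb{R}^d$ such that the exponentials $e^{2\pi i\langle\lambda,x\rangle}$, $\lambda\in\Lambda$, form an orthogonal basis of $L^2(\Omega)$ (an orthonormal basis when $\Omega$ has measure $1$). Let $m$ denote Lebesgue measure. **Proposition 3.3.** Let $\epsilon>0$, and let $E\subset[0,\tfrac32-\epsilon]$ be a measurable set with $m(E)=1$ that tiles $\mathbb{R}$ by translations along $\mathbb{Z}$, i.e. almost every $x\in\mathbb{R}$ lies in exactly one of the sets $E+k$, $k\in\mathbb{Z}$. Let $F\subset\mathbb{R}^n$ be a bounded measurable set with $m(F)=1$. If $E\times F\subset\mathbb{R}\times\mathbb{R}^n$ is spectral, then $F$ is spectral. -/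

import Mathlib

open MeasureTheory

/-- The character `x ↦ exp (2 π i ⟨ξ, x⟩)` of frequency `ξ`. -/
noncomputable def expChar {V : Type*} [NormedAddCommGroup V] [InnerProductSpace ℝ V]
    (ξ x : V) : ℂ :=
  Complex.exp (2 * (Real.pi : ℂ) * Complex.I * ((inner ℝ ξ x : ℝ) : ℂ))

/-- `Λ` is a spectrum of `Ω`: the exponentials with frequencies in the countable set `Λ` form an
orthogonal basis of `L²(Ω)`, that is, after division by their common norm `√|Ω|` they form an
orthonormal (Hilbert) basis. If `|Ω| = 1` the exponentials themselves are an orthonormal basis. -/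
def IsSpectrum {V : Type*} [NormedAddCommGroup V] [InnerProductSpace ℝ V] [MeasureSpace V]
    (Ω Λ : Set V) : Prop :=
  Λ.Countable ∧
    ∃ b : HilbertBasis Λ ℂ (Lp ℂ 2 ((volume : Measure V).restrict Ω)), ∀ ξ : Λ,
      (b ξ : V → ℂ) =ᵐ[(volume : Measure V).restrict Ω]
        fun x => ((Real.sqrt ((volume : Measure V).real Ω) : ℝ) : ℂ)⁻¹ * expChar (ξ : V) x

/-- A (bounded, measurable) set `Ω` of positive measure is spectral if it has a spectrum. -/
def IsSpectral {V : Type*} [NormedAddCommGroup V] [InnerProductSpace ℝ V] [MeasureSpace V]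
    (Ω : Set V) : Prop :=
  ∃ Λ : Set V, IsSpectrum Ω Λ

/-- `E` tiles `ℝ` by translations along `T`: almost every point of the line lies in exactly one of
the translates `E + t`, `t ∈ T`. -/
def TilesRealBy (E T : Set ℝ) : Prop :=
  ∀ᵐ x : ℝ, ∃! t : ℝ, t ∈ T ∧ x - t ∈ E

/-- The product set `E × F` in the Euclidean space `ℝ × ℝⁿ`; `WithLp 2` provides the Euclidean
inner product `⟨(s, u), (t, v)⟩ = s t + ⟨u, v⟩`, and the volume is Lebesgue measure. -/
def euclideanProd {n : ℕ} (E : Set ℝ) (F : Set (EuclideanSpace ℝ (Fin n))) :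
    Set (WithLp 2 (ℝ × EuclideanSpace ℝ (Fin n))) :=
  {p | p.fst ∈ E ∧ p.snd ∈ F}

/-!
Let `Λ` be a spectrum of `E × F` and `v ∈ L²(F)`. Parseval's identity for the products of `v` with
modulated indicator functions of sets `P ⊆ E` says that the map
`P ↦ (⟨e_ξ₂, v⟩ 1̂_P(ξ₁ - s))_{ξ ∈ Λ}` into `ℓ²(Λ)` has the Gram matrix `‖v‖² |P ∩ Q|`. This map is
additive and its inner products are invariant under translation of both sets. As `E` tiles by `ℤ`
and lies in an interval shorter than `3/2`, every `x ∈ (-1, 1)` is the difference of two density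
points of `E`. So small sets at distance `x` can be moved into `E`; averaging their defect from
`‖v‖² |P ∩ Q|` shows that the defect vanishes on `[0, 1)`. Hence `Λ` acts like a spectrum of
`[0, 1) × F`. The exponentials `e_ξ₂` with `ξ₁ ∈ [a, a + 1)` are then orthonormal, and integrating
Bessel's inequality against `|1̂_{[0, 1)}|²`, which has integral `1`, turns it into an equality for
almost every `a`.
-/

theorem exists_mem_Ioo_of_ae {p : ℝ → Prop} (h : ∀ᵐ w : ℝ, p w) {a b : ℝ} (hab : a < b) :
    ∃ w ∈ Set.Ioo a b, p w := by
  have hpos : volume (Set.Ioo a b) ≠ 0 := by simpa using hab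
  obtain ⟨w, hw, hwI⟩ := ((frequently_ae_mem_iff.2 hpos).and_eventually h).exists
  exact ⟨w, hw, hwI⟩

theorem ae_add_right {p : ℝ → Prop} (h : ∀ᵐ w, p w) (t : ℝ) : ∀ᵐ w, p (w + t) :=
  (measurePreserving_add_right (volume : Measure ℝ) t).quasiMeasurePreserving.ae h

namespace TilesRealBy

variable {E : Set ℝ} {L x : ℝ}

theorem ae_mem_or_add_one_mem (h : TilesRealBy E (Set.range ((↑) : ℤ → ℝ)))
    (hE : E ⊆ Set.Ico 0 2) : ∀ᵐ w : ℝ, w ∈ Set.Ico 0 1 → w ∈ E ∨ w + 1 ∈ E := by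
  filter_upwards [h] with w hw ⟨hw0, hw1⟩
  obtain ⟨_, ⟨⟨k, rfl⟩, hk⟩, -⟩ := hw
  obtain ⟨h0, h2⟩ := hE hk
  have hk_lt : k < 1 := by exact_mod_cast (by linarith : (k : ℝ) < 1)
  have hk_gt : -2 < k := by exact_mod_cast (by linarith : (-2 : ℝ) < k)
  obtain rfl | rfl : k = 0 ∨ k = -1 := by omega
  · exact .inl (by simpa using hk)
  · exact .inr (by simpa using hk)

theorem ae_mem_of_mem_Ioo (h : TilesRealBy E (Set.range ((↑) : ℤ → ℝ))) (hL0 : 0 ≤ L)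
    (hL1 : L < 1) (hE : E ⊆ Set.Icc 0 (1 + L)) : ∀ᵐ w : ℝ, w ∈ Set.Ioo L 1 → w ∈ E := by
  have hE' : E ⊆ Set.Ico 0 2 := hE.trans (Set.Icc_subset_Ico_right (by linarith))
  filter_upwards [h.ae_mem_or_add_one_mem hE'] with w hw ⟨hLw, hw1⟩
  exact (hw ⟨by linarith, hw1⟩).resolve_right fun hmem => by linarith [(hE hmem).2]

end TilesRealBy

/-- Moving along `z, z + (1 - x), z + 2 (1 - x), …`, the first point in `E` works: its
predecessor `w` satisfies `w ∉ E`, so `w + 1`, which is that first point plus `x`, is in `E`. -/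
theorem exists_mem_add_mem_of_orbit {E : Set ℝ} {L x z : ℝ} (hL : L < 1 / 2) (hx : 1 - L ≤ x)
    (hz : z ∈ Set.Ioo 0 (1 - x))
    (hmem : ∀ k : ℕ, z + k * (1 - x) ∈ Set.Ioo L 1 → z + k * (1 - x) ∈ E)
    (hor : ∀ k : ℕ, z + k * (1 - x) ∈ Set.Ico 0 1 →
      z + k * (1 - x) ∈ E ∨ z + k * (1 - x) + 1 ∈ E)
    (hzx : z + x ∈ E) : ∃ k : ℕ, z + k * (1 - x) ∈ E ∧ z + k * (1 - x) + x ∈ E := by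
  classical
  obtain ⟨hz0, hzx1⟩ := hz
  have hy : 0 < 1 - x := hz0.trans hzx1
  obtain ⟨j, hjL, hj1⟩ : ∃ j : ℕ, z + j * (1 - x) ∈ Set.Ioo L 1 := by
    obtain ⟨m, ⟨hmL, hmy⟩, -⟩ := existsUnique_add_zsmul_mem_Ioc hy z L
    rw [zsmul_eq_mul] at hmL hmy
    have hm : 0 ≤ m := by
      by_contra! hneg
      have : (m : ℝ) ≤ -1 := by exact_mod_cast Int.le_sub_one_of_lt hneg
      nlinarith
    lift m to ℕ using hm
    exact ⟨m, hmL, by push_cast at hmy; linarith⟩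
  have hex : ∃ k : ℕ, z + k * (1 - x) ∈ E := ⟨j, hmem j ⟨hjL, hj1⟩⟩
  refine ⟨Nat.find hex, Nat.find_spec hex, ?_⟩
  obtain hfirst | hne := eq_or_ne (Nat.find hex) 0
  · simpa [hfirst] using hzx
  · obtain ⟨k, hk⟩ := Nat.exists_eq_add_one_of_ne_zero hne
    have hkj : (k : ℝ) ≤ j := by
      exact_mod_cast (Nat.le_of_succ_le (hk ▸ Nat.find_min' hex (hmem j ⟨hjL, hj1⟩)))
    have hpred := (hor k ⟨by positivity, hj1.trans_le' (by gcongr)⟩).resolve_left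
      (Nat.find_min hex (by omega))
    convert hpred using 1
    rw [hk]
    push_cast
    ring

theorem TilesRealBy.volume_mem_add_mem_ne_zero {E : Set ℝ} {L x : ℝ}
    (h : TilesRealBy E (Set.range ((↑) : ℤ → ℝ))) (hL0 : 0 ≤ L) (hL : L < 1 / 2)
    (hE : E ⊆ Set.Icc 0 (1 + L)) (hx : |x| < 1) : volume {w | w ∈ E ∧ w + x ∈ E} ≠ 0 := by
  wlog hx0 : 0 ≤ x generalizing x
  · have hneg := this (x := -x) (by rwa [abs_neg]) (by linarith)
    rw [← measure_preimage_add_right volume x] at hneg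
    simpa [Set.preimage_ofPred_eq, and_comm] using hneg
  intro hnull
  have hx1 : x < 1 := (le_abs_self x).trans_lt hx
  have hmem := h.ae_mem_of_mem_Ioo hL0 (by linarith) hE
  have hor := h.ae_mem_or_add_one_mem (hE.trans (Set.Icc_subset_Ico_right (by linarith)))
  have hnot : ∀ᵐ w : ℝ, ¬(w ∈ E ∧ w + x ∈ E) := measure_eq_zero_iff_ae_notMem.1 hnull
  obtain hxL | hxL := lt_or_ge x (1 - L)
  · obtain ⟨w, ⟨hLw, hwx⟩, hw, hw', hn⟩ := exists_mem_Ioo_of_ae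
      (hmem.and ((ae_add_right hmem x).and hnot)) (show L < 1 - x by linarith)
    exact hn ⟨hw ⟨hLw, by linarith⟩, hw' ⟨by linarith, by linarith⟩⟩
  · have horbit : ∀ᵐ z : ℝ, ∀ k : ℕ, _ := ae_all_iff.2 fun k =>
      ae_add_right (hmem.and (hor.and hnot)) (k * (1 - x))
    obtain ⟨z, hz, hzk, hzx⟩ := exists_mem_Ioo_of_ae (horbit.and (ae_add_right hmem x))
      (show 0 < 1 - x by linarith)
    obtain ⟨k, hk⟩ := exists_mem_add_mem_of_orbit hL hxL hz (fun k => (hzk k).1)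
      (fun k => (hzk k).2.1) (hzx ⟨by linarith [hz.1], by linarith [hz.2]⟩)
    exact (hzk k).2.2 hk

/-- Bounded Borel subsets of the line, the domain of the vector measures below. -/
structure BddMeas (P : Set ℝ) : Prop where
  measurableSet : MeasurableSet P
  isBounded : Bornology.IsBounded P

namespace BddMeas

variable {P Q : Set ℝ}

theorem empty : BddMeas ∅ := ⟨.empty, Bornology.isBounded_empty⟩

theorem Ico (a b : ℝ) : BddMeas (Set.Ico a b) := ⟨measurableSet_Ico, Metric.isBounded_Ico a b⟩

theorem union (hP : BddMeas P) (hQ : BddMeas Q) : BddMeas (P ∪ Q) :=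
  ⟨hP.measurableSet.union hQ.measurableSet, hP.isBounded.union hQ.isBounded⟩

theorem inter (hP : BddMeas P) (hQ : MeasurableSet Q) : BddMeas (P ∩ Q) :=
  ⟨hP.measurableSet.inter hQ, hP.isBounded.subset Set.inter_subset_left⟩

theorem diff (hP : BddMeas P) (hQ : MeasurableSet Q) : BddMeas (P \ Q) :=
  ⟨hP.measurableSet.diff hQ, hP.isBounded.subset Set.sdiff_subset⟩

theorem preimage_add_right (hP : BddMeas P) (s : ℝ) : BddMeas ((· + s) ⁻¹' P) :=
  ⟨measurable_add_const s hP.measurableSet,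
    (isometry_add_right s).antilipschitz.isBounded_preimage hP.isBounded⟩

theorem volume_ne_top (hP : BddMeas P) : volume P ≠ ⊤ := hP.isBounded.measure_lt_top.ne

theorem induction_of_short {p : Set ℝ → Prop} {κ : ℝ} (hκ : 0 < κ)
    (short : ∀ P t, BddMeas P → P ⊆ Set.Ico t (t + κ) → p P)
    (union : ∀ P Q, BddMeas P → BddMeas Q → Disjoint P Q → p P → p Q → p (P ∪ Q))
    (hP : BddMeas P) : p P := by
  have hchain : ∀ (t : ℝ) (k : ℕ), p (P ∩ Set.Ico t (t + k * κ)) := by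
    intro t k
    induction k with
    | zero => exact short _ t (hP.inter measurableSet_Ico) (by simp)
    | succ k ih =>
      have hle : t + k * κ ≤ t + (k + 1 : ℕ) * κ := by gcongr; simp
      rw [← Set.Ico_union_Ico_eq_Ico (le_add_of_nonneg_right (by positivity)) hle,
        Set.inter_union_distrib_left]
      refine union _ _ (hP.inter measurableSet_Ico) (hP.inter measurableSet_Ico) ?_ ih
        (short _ (t + k * κ) (hP.inter measurableSet_Ico) ?_)
      · exact (Set.Ico_disjoint_Ico_same.mono Set.inter_subset_right Set.inter_subset_right)
      · refine Set.inter_subset_right.trans_eq ?_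
        push_cast
        ring_nf
  obtain ⟨r, hr⟩ := hP.isBounded.subset_ball 0
  obtain ⟨N, hN⟩ := exists_nat_gt (2 * r / κ)
  rw [div_lt_iff₀ hκ] at hN
  rw [Real.ball_eq_Ioo] at hr
  have hcover : P ⊆ Set.Ico (-r) (-r + N * κ) := hr.trans fun u hu =>
    ⟨by linarith [hu.1], by linarith [hu.2]⟩
  exact Set.inter_eq_left.2 hcover ▸ hchain (-r) N

end BddMeas

theorem volume_real_preimage_add_right (s : ℝ) (P : Set ℝ) :
    volume.real ((· + s) ⁻¹' P) = volume.real P := by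
  simp only [Measure.real, measure_preimage_add_right]

/-- All differences `y - z` with `y ∈ P` and `z ∈ Q` are within `r` of `x`; used to localise the
Gram kernel `(P, Q) ↦ ⟪U P, U Q⟫` near the line `y - z = x`. -/
def DiffNear (x r : ℝ) (P Q : Set ℝ) : Prop := ∀ y ∈ P, ∀ z ∈ Q, |y - z - x| < r

namespace DiffNear

variable {x r y z : ℝ} {P Q P' Q' : Set ℝ}

theorem mono (h : DiffNear x r P Q) (hP : P' ⊆ P) (hQ : Q' ⊆ Q) : DiffNear x r P' Q' :=
  fun y hy z hz => h y (hP hy) z (hQ hz)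

theorem preimage_add_right (h : DiffNear x r P Q) (s : ℝ) :
    DiffNear x r ((· + s) ⁻¹' P) ((· + s) ⁻¹' Q) := fun y hy z hz => by
  simpa using h _ hy _ hz

theorem left_subset (h : DiffNear x r P Q) (hz : z ∈ Q) : P ⊆ Set.Ioo (z + x - r) (z + x + r) :=
  fun y hy => by
    obtain ⟨h1, h2⟩ := abs_lt.1 (h y hy z hz)
    exact ⟨by linarith, by linarith⟩

theorem right_subset (h : DiffNear x r P Q) (hy : y ∈ P) : Q ⊆ Set.Ioo (y - x - r) (y - x + r) :=
  fun z hz => by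
    obtain ⟨h1, h2⟩ := abs_lt.1 (h y hy z hz)
    exact ⟨by linarith, by linarith⟩

end DiffNear

section Averaging

variable {P Q G E : Set ℝ}

theorem measurableSet_setOf_mem_add_mem (hP : MeasurableSet P) (hG : MeasurableSet G) :
    MeasurableSet {p : ℝ × ℝ | p.2 ∈ G ∧ p.2 + p.1 ∈ P} :=
  (measurable_snd hG).inter ((measurable_snd.add measurable_fst) hP)

theorem measurable_volume_preimage_add_right_inter (hP : MeasurableSet P) (hG : MeasurableSet G) :
    Measurable fun s => volume (G ∩ (· + s) ⁻¹' P) :=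
  measurable_measure_prodMk_left (measurableSet_setOf_mem_add_mem hP hG)

theorem lintegral_volume_preimage_add_right_inter (hP : MeasurableSet P) (hG : MeasurableSet G) :
    ∫⁻ s, volume (G ∩ (· + s) ⁻¹' P) = volume G * volume P := by
  rw [← Measure.prod_prod, ← (measurePreserving_prod_add_swap volume volume).measure_preimage
    (hG.prod hP).nullMeasurableSet]
  exact (Measure.prod_apply (measurableSet_setOf_mem_add_mem hP hG)).symm

theorem mul_volume_setOf_le_volume_preimage_inter_le (hP : BddMeas P) (hP0 : volume P ≠ 0)
    (hG : MeasurableSet G) (θ : ENNReal) :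
    θ * volume {s | θ * volume P ≤ volume (G ∩ (· + s) ⁻¹' P)} ≤ volume G := by
  rw [← ENNReal.mul_le_mul_iff_left hP0 hP.volume_ne_top, mul_right_comm,
    ← lintegral_volume_preimage_add_right_inter hP.measurableSet hG]
  exact mul_meas_ge_le_lintegral
    (measurable_volume_preimage_add_right_inter hP.measurableSet hG) _

theorem volume_setOf_sixteenth_le_volume_preimage_inter_le {r : ℝ} (hP : BddMeas P)
    (hP0 : volume P ≠ 0) (hG : MeasurableSet G) (hGr : volume G ≤ ENNReal.ofReal (r / 16)) :
    volume {s | 16⁻¹ * volume P ≤ volume (G ∩ (· + s) ⁻¹' P)} ≤ ENNReal.ofReal r := by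
  have h := (mul_volume_setOf_le_volume_preimage_inter_le hP hP0 hG 16⁻¹).trans hGr
  rw [ENNReal.inv_mul_le_iff (by norm_num) (by norm_num)] at h
  refine h.trans_eq ?_
  rw [show (16 : ENNReal) = ENNReal.ofReal 16 by norm_num, ← ENNReal.ofReal_mul (by norm_num)]
  ring_nf

theorem exists_preimage_volume_diff_le (hE : MeasurableSet E) {x q R : ℝ} (hR : 0 < R)
    (hq : volume (Metric.closedBall q R \ E) ≤ ENNReal.ofReal (R / 64))
    (hqx : volume (Metric.closedBall (q + x) R \ E) ≤ ENNReal.ofReal (R / 64))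
    (hP : BddMeas P) (hQ : BddMeas Q) (hPQ : DiffNear x (R / 4) P Q)
    (hP0 : volume P ≠ 0) (hQ0 : volume Q ≠ 0) :
    ∃ s, volume.real ((· + s) ⁻¹' P \ E) ≤ volume.real P / 16 ∧
      volume.real ((· + s) ⁻¹' Q \ E) ≤ volume.real Q / 16 := by
  let bad (c : ℝ) (S : Set ℝ) : Set ℝ :=
    {s | 16⁻¹ * volume S ≤ volume ((Metric.closedBall c R \ E) ∩ (· + s) ⁻¹' S)}
  have hbad {c S} (hS : BddMeas S) (hS0 : volume S ≠ 0)
      (hc : volume (Metric.closedBall c R \ E) ≤ ENNReal.ofReal (R / 64)) :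
      volume (bad c S) ≤ ENNReal.ofReal (R / 4) :=
    volume_setOf_sixteenth_le_volume_preimage_inter_le hS hS0
      (Metric.isClosed_closedBall.measurableSet.diff hE) (by convert hc using 2; ring)
  have hgood : ∀ {c S s}, BddMeas S → (· + s) ⁻¹' S ⊆ Metric.closedBall c R → s ∉ bad c S →
      volume.real ((· + s) ⁻¹' S \ E) ≤ volume.real S / 16 := by
    intro c S s hS hsub hs
    have hle : volume ((· + s) ⁻¹' S \ E) ≤ 16⁻¹ * volume S :=
      (measure_mono (Set.subset_inter (Set.sdiff_subset_sdiff_left hsub)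
        Set.sdiff_subset)).trans (not_le.1 hs).le
    have := ENNReal.toReal_mono (ENNReal.mul_ne_top (by simp) hS.volume_ne_top) hle
    rw [ENNReal.toReal_mul] at this
    simpa [Measure.real, div_eq_inv_mul] using this
  obtain ⟨y₀, hy₀⟩ := nonempty_of_measure_ne_zero hP0
  obtain ⟨z₀, hz₀⟩ := nonempty_of_measure_ne_zero hQ0
  have hlt : volume (bad (q + x) P ∪ bad q Q) < volume (Metric.closedBall (z₀ - q) (R / 2)) := by
    refine (measure_union_le _ _).trans_lt ((add_le_add (hbad hP hP0 hqx)
      (hbad hQ hQ0 hq)).trans_lt ?_)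
    rw [Real.volume_closedBall, ← ENNReal.ofReal_add (by positivity) (by positivity)]
    exact (ENNReal.ofReal_lt_ofReal_iff (by positivity)).2 (by linarith)
  obtain ⟨s, hsB, hs⟩ := Set.not_subset.1 fun h => (measure_mono h).not_gt hlt
  rw [Set.mem_union, not_or] at hs
  rw [Real.closedBall_eq_Icc] at hsB
  refine ⟨s, hgood hP (fun u hu => ?_) hs.1, hgood hQ (fun u hu => ?_) hs.2⟩
  · have := hPQ.left_subset hz₀ hu
    rw [Real.closedBall_eq_Icc]
    exact ⟨by linarith [this.1, hsB.2], by linarith [this.2, hsB.1]⟩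
  · have h1 := hPQ.right_subset hy₀ hu
    have h2 := hPQ.left_subset hz₀ hy₀
    rw [Real.closedBall_eq_Icc]
    exact ⟨by linarith [h1.1, h2.1, hsB.2], by linarith [h1.2, h2.2, hsB.1]⟩

theorem exists_eventually_volume_closedBall_diff_le {S : Set ℝ} (hS : MeasurableSet S)
    (hS0 : volume S ≠ 0) {θ : ENNReal} (hθ : 0 < θ) :
    ∃ q, ∀ᶠ R in nhdsWithin 0 (Set.Ioi 0),
      volume (Metric.closedBall q R \ S) ≤ θ * volume (Metric.closedBall q R) := by
  obtain ⟨q, hqS, hq⟩ := ((frequently_ae_mem_iff.2 hS0).and_eventually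
    (Besicovitch.ae_tendsto_measure_inter_div_of_measurableSet volume hS.compl)).exists
  rw [Set.indicator_of_notMem (by simpa using hqS)] at hq
  refine ⟨q, ?_⟩
  filter_upwards [hq.eventually (ge_mem_nhds hθ), self_mem_nhdsWithin] with R hR hR0
  rw [Set.sdiff_eq, Set.inter_comm]
  exact (ENNReal.div_le_iff (Metric.measure_closedBall_pos volume q hR0).ne'
    measure_closedBall_lt_top.ne).1 hR

end Averaging

/-- A finitely additive vector measure on bounded Borel sets with translation invariant Gram
kernel `(P, Q) ↦ ⟪U P, U Q⟫`, which on subsets of `E` (up to null sets) is `C` times the Lebesgue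
measure of the intersection, as for a stationary random measure. -/
structure IsWhiteNoiseOn {H : Type*} [NormedAddCommGroup H] [InnerProductSpace ℂ H]
    (U : Set ℝ → H) (C : ℝ) (E : Set ℝ) : Prop where
  nonneg : 0 ≤ C
  map_union : ∀ ⦃P Q⦄, BddMeas P → BddMeas Q → Disjoint P Q → U (P ∪ Q) = U P + U Q
  inner_shift : ∀ ⦃P Q⦄, BddMeas P → BddMeas Q → ∀ s,
    inner ℂ (U ((· + s) ⁻¹' P)) (U ((· + s) ⁻¹' Q)) = inner ℂ (U P) (U Q)
  inner_eq : ∀ ⦃P Q⦄, BddMeas P → BddMeas Q → P ≤ᵐ[volume] E → Q ≤ᵐ[volume] E →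
    inner ℂ (U P) (U Q) = ((C * volume.real (P ∩ Q) : ℝ) : ℂ)

/-- The difference between the Gram kernel of `U` and that of white noise of intensity `C`. -/
noncomputable def gramDefect {H : Type*} [NormedAddCommGroup H] [InnerProductSpace ℂ H]
    (U : Set ℝ → H) (C : ℝ) (P Q : Set ℝ) : ℂ :=
  inner ℂ (U P) (U Q) - ((C * volume.real (P ∩ Q) : ℝ) : ℂ)

/-- The Gram defect of sets whose differences are within `r` of `x` is at most `M` times the
geometric mean of their measures. -/
def GramDefectBound {H : Type*} [NormedAddCommGroup H] [InnerProductSpace ℂ H]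
    (U : Set ℝ → H) (C x r M : ℝ) : Prop :=
  ∀ ⦃P Q⦄, BddMeas P → BddMeas Q → DiffNear x r P Q →
    ‖gramDefect U C P Q‖ ≤ M * √(volume.real P * volume.real Q)

theorem norm_sq_eq_of_gramDefect_eq_zero {H : Type*} [NormedAddCommGroup H]
    [InnerProductSpace ℂ H] {U : Set ℝ → H} {C : ℝ} {P : Set ℝ} (h : gramDefect U C P P = 0) :
    ‖U P‖ ^ 2 = C * volume.real P := by
  rw [gramDefect, Set.inter_self, inner_self_eq_norm_sq_to_K, sub_eq_zero] at h
  exact Complex.ofReal_injective (by simpa using h)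

namespace IsWhiteNoiseOn

variable {H : Type*} [NormedAddCommGroup H] [InnerProductSpace ℂ H] {U : Set ℝ → H} {C : ℝ}
  {E P P' Q Q' : Set ℝ} {a c d q x M R : ℝ}

theorem congr {E' : Set ℝ} (hU : IsWhiteNoiseOn U C E) (h : E' =ᵐ[volume] E) :
    IsWhiteNoiseOn U C E' where
  nonneg := hU.nonneg
  map_union := hU.map_union
  inner_shift := hU.inner_shift
  inner_eq _ _ hP hQ hPE hQE := hU.inner_eq hP hQ (hPE.trans h.le) (hQE.trans h.le)

theorem map_empty (hU : IsWhiteNoiseOn U C E) : U ∅ = 0 := by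
  simpa using hU.map_union .empty .empty (Set.disjoint_empty ∅)

theorem gramDefect_union_left (hU : IsWhiteNoiseOn U C E) (hP : BddMeas P) (hP' : BddMeas P')
    (hd : Disjoint P P') (hQ : BddMeas Q) :
    gramDefect U C (P ∪ P') Q = gramDefect U C P Q + gramDefect U C P' Q := by
  have hvol : volume.real ((P ∪ P') ∩ Q) = volume.real (P ∩ Q) + volume.real (P' ∩ Q) := by
    rw [Set.union_inter_distrib_right]
    exact measureReal_union (hd.mono Set.inter_subset_left Set.inter_subset_left)
      (hP'.inter hQ.measurableSet).measurableSet (hP.inter hQ.measurableSet).volume_ne_top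
      (hP'.inter hQ.measurableSet).volume_ne_top
  simp only [gramDefect, hU.map_union hP hP' hd, inner_add_left, hvol]
  push_cast
  ring

theorem gramDefect_swap (U : Set ℝ → H) (C : ℝ) (P Q : Set ℝ) :
    gramDefect U C Q P = starRingEnd ℂ (gramDefect U C P Q) := by
  simp only [gramDefect, map_sub, inner_conj_symm, Complex.conj_ofReal, Set.inter_comm]

theorem gramDefect_union_right (hU : IsWhiteNoiseOn U C E) (hP : BddMeas P) (hQ : BddMeas Q)
    (hQ' : BddMeas Q') (hd : Disjoint Q Q') :
    gramDefect U C P (Q ∪ Q') = gramDefect U C P Q + gramDefect U C P Q' := by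
  rw [gramDefect_swap, hU.gramDefect_union_left hQ hQ' hd hP, map_add, ← gramDefect_swap,
    ← gramDefect_swap]

theorem gramDefect_preimage_add_right (hU : IsWhiteNoiseOn U C E) (hP : BddMeas P)
    (hQ : BddMeas Q) (s : ℝ) :
    gramDefect U C ((· + s) ⁻¹' P) ((· + s) ⁻¹' Q) = gramDefect U C P Q := by
  simp only [gramDefect, hU.inner_shift hP hQ s, ← Set.preimage_inter,
    volume_real_preimage_add_right]

theorem gramDefect_eq_zero_of_le (hU : IsWhiteNoiseOn U C E) (hP : BddMeas P) (hQ : BddMeas Q)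
    (hPE : P ≤ᵐ[volume] E) (hQE : Q ≤ᵐ[volume] E) : gramDefect U C P Q = 0 := by
  rw [gramDefect, hU.inner_eq hP hQ hPE hQE, sub_self]

theorem gramDefect_eq_add_diff (hU : IsWhiteNoiseOn U C E) (hE : MeasurableSet E)
    (hP : BddMeas P) (hQ : BddMeas Q) :
    gramDefect U C P Q = gramDefect U C (P ∩ E) (Q \ E) + gramDefect U C (P \ E) Q := by
  have hleft : gramDefect U C (P ∩ E) Q = gramDefect U C (P ∩ E) (Q \ E) := by
    conv_lhs => rw [← Set.inter_union_sdiff Q E]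
    rw [hU.gramDefect_union_right (hP.inter hE) (hQ.inter hE) (hQ.diff hE)
      Set.disjoint_sdiff_inter.symm, hU.gramDefect_eq_zero_of_le (hP.inter hE) (hQ.inter hE)
      Set.inter_subset_right.eventuallyLE Set.inter_subset_right.eventuallyLE, zero_add]
  conv_lhs => rw [← Set.inter_union_sdiff P E]
  rw [hU.gramDefect_union_left (hP.inter hE) (hP.diff hE) Set.disjoint_sdiff_inter.symm hQ, hleft]

theorem norm_sq_of_subset_Ico (hU : IsWhiteNoiseOn U C E)
    (hI : Set.Ico a (a + d) ≤ᵐ[volume] E) (hP : BddMeas P) {t : ℝ}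
    (h : P ⊆ Set.Ico t (t + d)) : ‖U P‖ ^ 2 = C * volume.real P := by
  have hs : (· + (t - a)) ⁻¹' P ⊆ Set.Ico a (a + d) := fun u hu => by
    have := h hu
    exact ⟨by linarith [this.1], by linarith [this.2]⟩
  have hE := hs.eventuallyLE.trans hI
  refine norm_sq_eq_of_gramDefect_eq_zero ?_
  rw [← hU.gramDefect_preimage_add_right hP hP (t - a)]
  exact hU.gramDefect_eq_zero_of_le (hP.preimage_add_right _) (hP.preimage_add_right _) hE hE

theorem norm_gramDefect_le_of_norm_sq (hC : 0 ≤ C) (hP : BddMeas P) (hQ : BddMeas Q)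
    (hUP : ‖U P‖ ^ 2 = C * volume.real P) (hUQ : ‖U Q‖ ^ 2 = C * volume.real Q) :
    ‖gramDefect U C P Q‖ ≤ 2 * C * √(volume.real P * volume.real Q) := by
  have hinner : ‖(inner ℂ (U P) (U Q) : ℂ)‖ ≤ C * √(volume.real P * volume.real Q) := by
    refine (norm_inner_le_norm _ _).trans (le_of_eq ?_)
    rw [← Real.sqrt_sq (by positivity : 0 ≤ ‖U P‖ * ‖U Q‖), mul_pow, hUP, hUQ,
      mul_mul_mul_comm, Real.sqrt_mul (by positivity), Real.sqrt_mul_self hC]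
  have hvol : volume.real (P ∩ Q) ≤ √(volume.real P * volume.real Q) := by
    refine Real.le_sqrt_of_sq_le ?_
    rw [sq]
    exact mul_le_mul (measureReal_mono Set.inter_subset_left hP.volume_ne_top)
      (measureReal_mono Set.inter_subset_right hQ.volume_ne_top) measureReal_nonneg
      measureReal_nonneg
  calc ‖gramDefect U C P Q‖
      ≤ ‖(inner ℂ (U P) (U Q) : ℂ)‖ + ‖((C * volume.real (P ∩ Q) : ℝ) : ℂ)‖ := norm_sub_le _ _
    _ ≤ C * √(volume.real P * volume.real Q) + C * √(volume.real P * volume.real Q) := by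
        rw [Complex.norm_real, Real.norm_of_nonneg (mul_nonneg hC measureReal_nonneg)]
        gcongr
    _ = 2 * C * √(volume.real P * volume.real Q) := by ring

/-- A common translate of `P` and `Q` lies in `E` up to a sixteenth of its mass, and the Gram
kernel has no defect on the part inside `E`. -/
theorem gramDefectBound_half (hU : IsWhiteNoiseOn U C E) (hE : MeasurableSet E)
    (hR : 0 < R) (hM0 : 0 ≤ M)
    (hq : volume (Metric.closedBall q R \ E) ≤ ENNReal.ofReal (R / 64))
    (hqx : volume (Metric.closedBall (q + x) R \ E) ≤ ENNReal.ofReal (R / 64))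
    (hM : GramDefectBound U C x (R / 4) M) : GramDefectBound U C x (R / 4) (M / 2) := by
  intro P Q hP hQ hPQ
  by_cases h0 : volume.real P * volume.real Q = 0
  · simpa [h0] using hM hP hQ hPQ
  obtain ⟨hP0, hQ0⟩ := mul_ne_zero_iff.1 h0
  obtain ⟨s, hsP, hsQ⟩ := exists_preimage_volume_diff_le hE hR hq hqx hP hQ hPQ
    (fun h => hP0 (measureReal_eq_zero_iff hP.volume_ne_top |>.2 h))
    (fun h => hQ0 (measureReal_eq_zero_iff hQ.volume_ne_top |>.2 h))
  have hPs := hP.preimage_add_right s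
  have hQs := hQ.preimage_add_right s
  have hPQs := hPQ.preimage_add_right s
  have hsqrt : √(volume.real P * volume.real Q / 16) = √(volume.real P * volume.real Q) / 4 := by
    rw [Real.sqrt_div (by positivity), show (16 : ℝ) = 4 ^ 2 by norm_num,
      Real.sqrt_sq (by norm_num)]
  have hPE : volume.real ((· + s) ⁻¹' P ∩ E) ≤ volume.real P :=
    (measureReal_mono Set.inter_subset_left hPs.volume_ne_top).trans_eq
      (volume_real_preimage_add_right s P)
  rw [← hU.gramDefect_preimage_add_right hP hQ s, hU.gramDefect_eq_add_diff hE hPs hQs]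
  refine (norm_add_le _ _).trans ((add_le_add
    (hM (hPs.inter hE) (hQs.diff hE) (hPQs.mono Set.inter_subset_left Set.sdiff_subset))
    (hM (hPs.diff hE) hQs (hPQs.mono Set.sdiff_subset subset_rfl))).trans ?_)
  calc M * √(volume.real ((· + s) ⁻¹' P ∩ E) * volume.real ((· + s) ⁻¹' Q \ E))
        + M * √(volume.real ((· + s) ⁻¹' P \ E) * volume.real ((· + s) ⁻¹' Q))
      ≤ M * √(volume.real P * (volume.real Q / 16))
        + M * √(volume.real P / 16 * volume.real Q) := by
        rw [volume_real_preimage_add_right]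
        gcongr
    _ = M / 2 * √(volume.real P * volume.real Q) := by
        rw [← mul_div_assoc, div_mul_eq_mul_div, hsqrt]
        ring

theorem gramDefectBound_two_mul (hU : IsWhiteNoiseOn U C E)
    (hI : Set.Ico a (a + d) ≤ᵐ[volume] E) {r : ℝ} (hr : 2 * r ≤ d) :
    GramDefectBound U C x r (2 * C) := by
  intro P Q hP hQ hPQ
  obtain rfl | ⟨y, hy⟩ := P.eq_empty_or_nonempty
  · simp [gramDefect, hU.map_empty]
  obtain rfl | ⟨z, hz⟩ := Q.eq_empty_or_nonempty
  · simp [gramDefect, hU.map_empty]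
  have hP' : P ⊆ Set.Ico (z + x - r) (z + x - r + d) :=
    (hPQ.left_subset hz).trans fun u hu => ⟨hu.1.le, by linarith [hu.2]⟩
  have hQ' : Q ⊆ Set.Ico (y - x - r) (y - x - r + d) :=
    (hPQ.right_subset hy).trans fun u hu => ⟨hu.1.le, by linarith [hu.2]⟩
  exact norm_gramDefect_le_of_norm_sq hU.nonneg hP hQ (hU.norm_sq_of_subset_Ico hI hP hP')
    (hU.norm_sq_of_subset_Ico hI hQ hQ')

theorem gramDefect_eq_zero_of_volume_diff_le (hU : IsWhiteNoiseOn U C E) (hE : MeasurableSet E)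
    (hR : 0 < R) (hRd : R ≤ d) (hI : Set.Ico a (a + d) ≤ᵐ[volume] E)
    (hq : volume (Metric.closedBall q R \ E) ≤ ENNReal.ofReal (R / 64))
    (hqx : volume (Metric.closedBall (q + x) R \ E) ≤ ENNReal.ofReal (R / 64))
    (hP : BddMeas P) (hQ : BddMeas Q) (hPQ : DiffNear x (R / 4) P Q) :
    gramDefect U C P Q = 0 := by
  have hpow : ∀ k : ℕ, GramDefectBound U C x (R / 4) (2 * C * (1 / 2) ^ k) := by
    intro k
    induction k with
    | zero => simpa using hU.gramDefectBound_two_mul hI (by linarith)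
    | succ k ih =>
      have hC := hU.nonneg
      have := hU.gramDefectBound_half hE hR (by positivity) hq hqx ih
      rwa [pow_succ, ← mul_assoc, mul_one_div]
  have hlim : Filter.Tendsto (fun k : ℕ => 2 * C * (1 / 2 : ℝ) ^ k *
      √(volume.real P * volume.real Q)) Filter.atTop (nhds 0) := by
    simpa using ((tendsto_pow_atTop_nhds_zero_of_lt_one (r := (1 / 2 : ℝ)) (by norm_num)
      (by norm_num)).const_mul (2 * C)).mul_const √(volume.real P * volume.real Q)
  exact norm_le_zero_iff.1 (ge_of_tendsto' hlim fun k => hpow k hP hQ hPQ)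

theorem exists_gramDefect_eq_zero_of_diffNear (hU : IsWhiteNoiseOn U C E) (hE : MeasurableSet E)
    (hd : 0 < d) (hI : Set.Ico a (a + d) ≤ᵐ[volume] E)
    (hx : volume {w | w ∈ E ∧ w + x ∈ E} ≠ 0) :
    ∃ r > 0, ∀ P Q, BddMeas P → BddMeas Q → DiffNear x r P Q → gramDefect U C P Q = 0 := by
  have hS : MeasurableSet {w | w ∈ E ∧ w + x ∈ E} := hE.inter (measurable_add_const x hE)
  obtain ⟨q, hq⟩ := exists_eventually_volume_closedBall_diff_le hS hx
    (ENNReal.ofReal_pos.2 (by norm_num : (0 : ℝ) < 1 / 128))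
  obtain ⟨R, hqR, hR, hRd⟩ := (hq.and (Ioc_mem_nhdsGT hd)).exists
  replace hqR : volume (Metric.closedBall q R \ {w | w ∈ E ∧ w + x ∈ E}) ≤
      ENNReal.ofReal (R / 64) := by
    refine hqR.trans_eq ?_
    rw [Real.volume_closedBall, ← ENNReal.ofReal_mul (by norm_num)]
    ring_nf
  refine ⟨R / 4, by positivity, fun P Q hP hQ hPQ =>
    hU.gramDefect_eq_zero_of_volume_diff_le (q := q) hE hR hRd hI ?_ ?_ hP hQ hPQ⟩
  · exact (measure_mono (Set.sdiff_subset_sdiff_right fun w hw => hw.1)).trans hqR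
  · rw [← measure_preimage_add_right volume x]
    refine (measure_mono ?_).trans hqR
    rintro w ⟨hw, hwE⟩
    exact ⟨by simpa [Real.dist_eq] using hw, fun h => hwE h.2⟩

theorem gramDefect_eq_zero_of_subset_Ico (hU : IsWhiteNoiseOn U C E)
    (hloc : ∀ x ∈ Set.Icc (-c) c, ∃ r > 0, ∀ P Q, BddMeas P → BddMeas Q → DiffNear x r P Q →
      gramDefect U C P Q = 0)
    (hP : BddMeas P) (hQ : BddMeas Q) (hPc : P ⊆ Set.Ico 0 c) (hQc : Q ⊆ Set.Ico 0 c) :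
    gramDefect U C P Q = 0 := by
  choose! r hr0 hr using hloc
  obtain ⟨δ, hδ, hleb⟩ := lebesgue_number_lemma_of_metric (s := Set.Icc (-c) c)
    (c := fun x : Set.Icc (-c) c => Metric.ball (x : ℝ) (r x)) isCompact_Icc
    (fun _ => Metric.isOpen_ball)
    (fun x hx => Set.mem_iUnion.2 ⟨⟨x, hx⟩, Metric.mem_ball_self (hr0 x hx)⟩)
  have hshort : ∀ {P Q : Set ℝ} {s t : ℝ}, BddMeas P → BddMeas Q → P ⊆ Set.Ico 0 c →
      Q ⊆ Set.Ico 0 c → P ⊆ Set.Ico s (s + δ / 2) → Q ⊆ Set.Ico t (t + δ / 2) →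
      gramDefect U C P Q = 0 := by
    intro P Q s t hP hQ hPc hQc hPs hQt
    obtain rfl | ⟨y₀, hy₀⟩ := P.eq_empty_or_nonempty
    · simp [gramDefect, hU.map_empty]
    obtain rfl | ⟨z₀, hz₀⟩ := Q.eq_empty_or_nonempty
    · simp [gramDefect, hU.map_empty]
    obtain ⟨x, hx⟩ := hleb (y₀ - z₀) ⟨by linarith [(hPc hy₀).1, (hQc hz₀).2],
      by linarith [(hPc hy₀).2, (hQc hz₀).1]⟩
    refine hr x x.2 P Q hP hQ fun y hy z hz => hx ?_
    rw [Real.ball_eq_Ioo]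
    exact ⟨by linarith [(hPs hy).1, (hPs hy₀).2, (hQt hz).2, (hQt hz₀).1],
      by linarith [(hPs hy).2, (hPs hy₀).1, (hQt hz).1, (hQt hz₀).2]⟩
  refine BddMeas.induction_of_short (p := fun P => P ⊆ Set.Ico 0 c → gramDefect U C P Q = 0)
    (half_pos hδ) (fun P s hP hPs hPc => ?_) (fun P P' hP hP' hd ihP ihP' hPc => ?_) hP hPc
  · refine BddMeas.induction_of_short (p := fun Q => Q ⊆ Set.Ico 0 c → gramDefect U C P Q = 0)
      (half_pos hδ) (fun Q t hQ hQt hQc => hshort hP hQ hPc hQc hPs hQt)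
      (fun Q Q' hQ hQ' hd ihQ ihQ' hQc => ?_) hQ hQc
    obtain ⟨hQc, hQc'⟩ := Set.union_subset_iff.1 hQc
    rw [hU.gramDefect_union_right hP hQ hQ' hd, ihQ hQc, ihQ' hQc', add_zero]
  · obtain ⟨hPc, hPc'⟩ := Set.union_subset_iff.1 hPc
    rw [hU.gramDefect_union_left hP hP' hd hQ, ihP hPc, ihP' hPc', add_zero]

theorem norm_sq_Ico_of_lt_one (hU : IsWhiteNoiseOn U C E) (hE : MeasurableSet E)
    (hd : 0 < d) (hI : Set.Ico a (a + d) ≤ᵐ[volume] E)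
    (hx : ∀ x, |x| < 1 → volume {w | w ∈ E ∧ w + x ∈ E} ≠ 0) (hc0 : 0 ≤ c) (hc1 : c < 1) :
    ‖U (Set.Ico 0 c)‖ ^ 2 = C * c := by
  have hdefect : gramDefect U C (Set.Ico 0 c) (Set.Ico 0 c) = 0 :=
    hU.gramDefect_eq_zero_of_subset_Ico (fun x hxc => hU.exists_gramDefect_eq_zero_of_diffNear
      hE hd hI (hx x ((abs_le.2 hxc).trans_lt hc1))) (.Ico 0 c) (.Ico 0 c) subset_rfl subset_rfl
  rw [norm_sq_eq_of_gramDefect_eq_zero hdefect, Real.volume_real_Ico_of_le hc0, sub_zero]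

theorem norm_sq_Ico_one (hU : IsWhiteNoiseOn U C E) (hE : MeasurableSet E)
    (hd : 0 < d) (hI : Set.Ico a (a + d) ≤ᵐ[volume] E)
    (hx : ∀ x, |x| < 1 → volume {w | w ∈ E ∧ w + x ∈ E} ≠ 0) :
    ‖U (Set.Ico 0 1)‖ ^ 2 = C := by
  have hnear : ∀ᶠ c in nhdsWithin (1 : ℝ) (Set.Iio 1), c ∈ Set.Ioo (max 0 (1 - d)) 1 :=
    Ioo_mem_nhdsLT (by simpa using hd)
  have hcoe : Filter.Tendsto id (nhdsWithin (1 : ℝ) (Set.Iio 1)) (nhds 1) := nhdsWithin_le_nhds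
  have htail : Filter.Tendsto (fun c => ‖U (Set.Ico 0 c) - U (Set.Ico 0 1)‖ ^ 2)
      (nhdsWithin 1 (Set.Iio 1)) (nhds 0) := by
    have hlim : Filter.Tendsto (fun c => C * (1 - c)) (nhdsWithin 1 (Set.Iio 1)) (nhds 0) := by
      simpa using (hcoe.const_sub 1).const_mul C
    refine hlim.congr' (hnear.mono fun c hc => ?_)
    obtain ⟨hc0, hcd⟩ := max_lt_iff.1 hc.1
    have hsplit : U (Set.Ico 0 1) = U (Set.Ico 0 c) + U (Set.Ico c 1) := by
      rw [← Set.Ico_union_Ico_eq_Ico hc0.le hc.2.le,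
        hU.map_union (.Ico 0 c) (.Ico c 1) Set.Ico_disjoint_Ico_same]
    simp only [hsplit, sub_add_cancel_left, norm_neg]
    rw [hU.norm_sq_of_subset_Ico hI (.Ico c 1) (Set.Ico_subset_Ico_right (by linarith)),
      Real.volume_real_Ico_of_le hc.2.le]
  have hU1 : Filter.Tendsto (fun c => U (Set.Ico 0 c)) (nhdsWithin 1 (Set.Iio 1))
      (nhds (U (Set.Ico 0 1))) := by
    rw [tendsto_iff_norm_sub_tendsto_zero]
    simpa using htail.sqrt
  have hC : Filter.Tendsto (fun c => C * c) (nhdsWithin 1 (Set.Iio 1)) (nhds C) := by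
    simpa using hcoe.const_mul C
  refine tendsto_nhds_unique (hU1.norm.pow 2) (hC.congr' (hnear.mono fun c hc => ?_))
  exact (hU.norm_sq_Ico_of_lt_one hE hd hI hx (max_lt_iff.1 hc.1).1.le hc.2).symm

end IsWhiteNoiseOn

section expChar

variable {V : Type*} [NormedAddCommGroup V] [InnerProductSpace ℝ V]

theorem expChar_add_left (ξ η x : V) : expChar (ξ + η) x = expChar ξ x * expChar η x := by
  simp only [expChar, inner_add_left, ← Complex.exp_add]
  push_cast
  ring_nf

theorem expChar_add_right (ξ x y : V) : expChar ξ (x + y) = expChar ξ x * expChar ξ y := by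
  simp only [expChar, inner_add_right, ← Complex.exp_add]
  push_cast
  ring_nf

theorem norm_expChar (ξ x : V) : ‖expChar ξ x‖ = 1 := by
  rw [expChar, show 2 * (Real.pi : ℂ) * Complex.I * ((inner ℝ ξ x : ℝ) : ℂ) =
    ((2 * Real.pi * inner ℝ ξ x : ℝ) : ℂ) * Complex.I by push_cast; ring]
  exact Complex.norm_exp_ofReal_mul_I _

theorem conj_expChar (ξ x : V) : starRingEnd ℂ (expChar ξ x) = expChar (-ξ) x := by
  simp [expChar, ← Complex.exp_conj, Complex.conj_ofNat]

theorem continuous_expChar (ξ : V) : Continuous (expChar ξ) := by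
  unfold expChar
  fun_prop

theorem expChar_neg_left_mul_self (ξ x : V) : expChar (-ξ) x * expChar ξ x = 1 := by
  rw [← expChar_add_left, neg_add_cancel, expChar, inner_zero_left]
  simp

end expChar

/-- The Fourier transform of the indicator function of `P`. -/
noncomputable def setFourier (P : Set ℝ) (ξ : ℝ) : ℂ := ∫ x in P, expChar (-ξ) x

theorem BddMeas.integrableOn_expChar {P : Set ℝ} (hP : BddMeas P) (ξ : ℝ) :
    IntegrableOn (expChar ξ) P :=
  Measure.integrableOn_of_bounded (M := 1) hP.volume_ne_top
    (continuous_expChar ξ).aestronglyMeasurable (.of_forall fun x => (norm_expChar ξ x).le)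

theorem setFourier_union {P Q : Set ℝ} (hP : BddMeas P) (hQ : BddMeas Q) (hd : Disjoint P Q)
    (ξ : ℝ) : setFourier (P ∪ Q) ξ = setFourier P ξ + setFourier Q ξ :=
  setIntegral_union hd hQ.measurableSet (hP.integrableOn_expChar _) (hQ.integrableOn_expChar _)

theorem setFourier_preimage_add_right (P : Set ℝ) (s ξ : ℝ) :
    setFourier ((· + s) ⁻¹' P) ξ = expChar ξ s * setFourier P ξ := by
  have h := (measurePreserving_add_right (volume : Measure ℝ) s).setIntegral_preimage_emb
    (measurableEmbedding_addRight s) (fun x => expChar (-ξ) x) P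
  simp only [expChar_add_right, integral_mul_const] at h
  rw [setFourier, setFourier, ← h, mul_comm, mul_assoc, expChar_neg_left_mul_self, mul_one]

section weighted

variable {ι : Type*} {w : ι → ℂ} {l : ι → ℝ} {C a d : ℝ} {E P Q : Set ℝ}

/-- The functions `i ↦ w i * 1̂_P (l i)`, for `P` essentially contained in `E`, have the inner
products `C * |P ∩ Q|` of white noise. -/
def ReproducesVolumeOn (w : ι → ℂ) (l : ι → ℝ) (C : ℝ) (E : Set ℝ) : Prop :=
  ∀ ⦃P Q⦄, BddMeas P → BddMeas Q → P ≤ᵐ[volume] E → Q ≤ᵐ[volume] E →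
    HasSum (fun i => (inner ℂ (w i * setFourier P (l i)) (w i * setFourier Q (l i)) : ℂ))
      ((C * volume.real (P ∩ Q) : ℝ) : ℂ)

/-- The square summable family `i ↦ w i * 1̂_P (l i)`, with junk value `0` if it is not square
summable. -/
noncomputable def weightedFourier (w : ι → ℂ) (l : ι → ℝ) (P : Set ℝ) : lp (fun _ : ι => ℂ) 2 :=
  open Classical in
  if h : Memℓp (fun i => w i * setFourier P (l i)) 2 then ⟨_, h⟩ else 0

theorem weightedFourier_apply (h : Memℓp (fun i => w i * setFourier P (l i)) 2) (i : ι) :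
    weightedFourier w l P i = w i * setFourier P (l i) := by
  rw [weightedFourier, dif_pos h]

namespace ReproducesVolumeOn

theorem memℓp_of_subset_Ico (h : ReproducesVolumeOn w l C E)
    (hI : Set.Ico a (a + d) ≤ᵐ[volume] E) (hP : BddMeas P) {t : ℝ}
    (hPt : P ⊆ Set.Ico t (t + d)) : Memℓp (fun i => w i * setFourier P (l i)) 2 := by
  have hs : (· + (t - a)) ⁻¹' P ⊆ Set.Ico a (a + d) := fun u hu => by
    have := hPt hu
    exact ⟨by linarith [this.1], by linarith [this.2]⟩
  have hE := hs.eventuallyLE.trans hI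
  have hsum := (h (hP.preimage_add_right _) (hP.preimage_add_right _) hE hE).summable.norm
  refine memℓp_gen (hsum.congr fun i => ?_)
  rw [setFourier_preimage_add_right, inner_self_eq_norm_sq_to_K]
  simp [norm_expChar]

theorem memℓp (h : ReproducesVolumeOn w l C E) (hd : 0 < d)
    (hI : Set.Ico a (a + d) ≤ᵐ[volume] E) (hP : BddMeas P) :
    Memℓp (fun i => w i * setFourier P (l i)) 2 := by
  refine hP.induction_of_short hd (fun P t hP hPt => h.memℓp_of_subset_Ico hI hP hPt)
    (fun P Q hP hQ hPQ hmemP hmemQ => ?_)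
  convert hmemP.add hmemQ using 1
  ext i
  simp only [setFourier_union hP hQ hPQ, mul_add, Pi.add_apply]

theorem isWhiteNoiseOn (h : ReproducesVolumeOn w l C E) (hC : 0 ≤ C) (hd : 0 < d)
    (hI : Set.Ico a (a + d) ≤ᵐ[volume] E) : IsWhiteNoiseOn (weightedFourier w l) C E := by
  have happly {P} (hP : BddMeas P) := weightedFourier_apply (h.memℓp hd hI hP)
  have hinner {P Q} (hP : BddMeas P) (hQ : BddMeas Q) : HasSum
      (fun i => (inner ℂ (w i * setFourier P (l i)) (w i * setFourier Q (l i)) : ℂ))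
      (inner ℂ (weightedFourier w l P) (weightedFourier w l Q)) := by
    simpa only [happly hP, happly hQ] using
      lp.hasSum_inner (𝕜 := ℂ) (weightedFourier w l P) (weightedFourier w l Q)
  refine ⟨hC, fun P Q hP hQ hd => ?_, fun P Q hP hQ s => ?_, fun P Q hP hQ hPE hQE =>
    (hinner hP hQ).unique (h hP hQ hPE hQE)⟩
  · ext i
    simp only [lp.coeFn_add, Pi.add_apply, happly hP, happly hQ, happly (hP.union hQ),
      setFourier_union hP hQ hd, mul_add]
  · refine (hinner (hP.preimage_add_right s) (hQ.preimage_add_right s)).unique ?_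
    refine (hinner hP hQ).congr_fun fun i => ?_
    simp only [setFourier_preimage_add_right, RCLike.inner_apply, map_mul, conj_expChar]
    linear_combination (starRingEnd ℂ (w i) * starRingEnd ℂ (setFourier P (l i)) * w i *
      setFourier Q (l i)) * expChar_neg_left_mul_self (l i) s

theorem hasSum_sq_Ico_one (h : ReproducesVolumeOn w l C E) (hE : NullMeasurableSet E) (hC : 0 ≤ C)
    (hd : 0 < d) (hI : Set.Ico a (a + d) ≤ᵐ[volume] E)
    (hx : ∀ x, |x| < 1 → volume {w | w ∈ E ∧ w + x ∈ E} ≠ 0) :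
    HasSum (fun i => ‖w i‖ ^ 2 * ‖setFourier (Set.Ico 0 1) (l i)‖ ^ 2) C := by
  obtain ⟨E₀, -, hE₀, hE₀E⟩ := hE.exists_measurable_subset_ae_eq
  have hx₀ : ∀ x, |x| < 1 → volume {w | w ∈ E₀ ∧ w + x ∈ E₀} ≠ 0 := by
    intro x hx1 hnull
    refine hx x hx1 ((measure_congr ?_).trans hnull)
    exact hE₀E.symm.inter ((measurePreserving_add_right volume x).quasiMeasurePreserving
      |>.preimage_ae_eq hE₀E.symm)
  have hnorm := ((h.isWhiteNoiseOn hC hd hI).congr hE₀E).norm_sq_Ico_one hE₀ hd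
    (hI.trans hE₀E.symm.le) hx₀
  have hsum := lp.hasSum_norm (by norm_num) (weightedFourier w l (Set.Ico 0 1))
  simpa [weightedFourier_apply (h.memℓp hd hI (.Ico 0 1)), hnorm, mul_pow] using hsum

end ReproducesVolumeOn

end weighted

section expLp

variable {V : Type*} [NormedAddCommGroup V] [InnerProductSpace ℝ V] [MeasurableSpace V]
  [BorelSpace V]

theorem memLp_expChar (μ : Measure V) [IsFiniteMeasure μ] (ξ : V) : MemLp (expChar ξ) 2 μ :=
  MemLp.of_bound (continuous_expChar ξ).aestronglyMeasurable 1
    (.of_forall fun x => (norm_expChar ξ x).le)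

/-- The exponential of frequency `ξ` as an element of `L²(μ)`. -/
noncomputable def expLp (μ : Measure V) [IsFiniteMeasure μ] (ξ : V) : Lp ℂ 2 μ :=
  (memLp_expChar μ ξ).toLp _

/-- The exponential of frequency `ξ`, cut off outside `P`, as an element of `L²(μ)`. -/
noncomputable def cutoffExpLp (μ : Measure V) [IsFiniteMeasure μ] (ξ : V) {P : Set V}
    (hP : MeasurableSet P) : Lp ℂ 2 μ :=
  ((memLp_expChar μ ξ).indicator hP).toLp _

variable {μ : Measure V} [IsFiniteMeasure μ]

theorem coeFn_expLp (ξ : V) : expLp μ ξ =ᵐ[μ] expChar ξ := MemLp.coeFn_toLp _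

theorem cutoffExpLp_univ (ξ : V) : cutoffExpLp μ ξ .univ = expLp μ ξ := by
  simp only [cutoffExpLp, expLp, Set.indicator_univ]

theorem inner_cutoffExpLp (ξ η : V) {P Q : Set V} (hP : MeasurableSet P) (hQ : MeasurableSet Q) :
    inner ℂ (cutoffExpLp μ ξ hP) (cutoffExpLp μ η hQ) =
      ∫ x in P ∩ Q, expChar (-(ξ - η)) x ∂μ := by
  rw [L2.inner_def, ← integral_indicator (hP.inter hQ)]
  refine integral_congr_ae ?_
  filter_upwards [((memLp_expChar μ ξ).indicator hP).coeFn_toLp,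
    ((memLp_expChar μ η).indicator hQ).coeFn_toLp] with x hx hy
  have hadd : expChar (-(ξ - η)) x = expChar (-ξ) x * expChar η x := by
    rw [← expChar_add_left]
    congr 1
    abel
  rw [cutoffExpLp, cutoffExpLp, RCLike.inner_apply', hx, hy]
  by_cases hxP : x ∈ P <;> by_cases hxQ : x ∈ Q <;>
    simp [hxP, hxQ, conj_expChar, -neg_sub, hadd]

theorem norm_expLp [IsProbabilityMeasure μ] (ξ : V) : ‖expLp μ ξ‖ = 1 := by
  rw [← sq_eq_sq₀ (norm_nonneg _) zero_le_one, ← Complex.ofReal_inj]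
  have h := inner_self_eq_norm_sq_to_K (𝕜 := ℂ) (expLp μ ξ)
  rw [← cutoffExpLp_univ, inner_cutoffExpLp] at h
  simpa [expChar, cutoffExpLp_univ, eq_comm] using h

theorem inner_cutoffExpLp_restrict {E : Set ℝ} [IsFiniteMeasure (volume.restrict E)] {s t : ℝ}
    {P Q : Set ℝ} (hP : MeasurableSet P) (hQ : MeasurableSet Q)
    (hPQ : (P ∩ Q : Set ℝ) ≤ᵐ[volume] E) :
    inner ℂ (cutoffExpLp (volume.restrict E) s hP) (cutoffExpLp (volume.restrict E) t hQ) =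
      setFourier (P ∩ Q) (s - t) := by
  rw [inner_cutoffExpLp, Measure.restrict_restrict (hP.inter hQ), setFourier]
  exact setIntegral_congr_set (Filter.inter_eventuallyEq_left.2 hPQ)

end expLp

section spectrum

variable {V : Type*} [NormedAddCommGroup V] [InnerProductSpace ℝ V] [MeasureSpace V]
  [BorelSpace V] {F : Set V} [IsProbabilityMeasure (volume.restrict F)]

theorem isSpectrum_iff {Λ : Set V} : IsSpectrum F Λ ↔ Λ.Countable ∧
    ∃ b : HilbertBasis Λ ℂ (Lp ℂ 2 (volume.restrict F)),
      ∀ ξ, b ξ = expLp (volume.restrict F) (ξ : V) := by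
  have hF : volume.real F = 1 := by
    rw [← measureReal_restrict_apply_univ, probReal_univ]
  simp only [IsSpectrum, hF, Real.sqrt_one, Complex.ofReal_one, inv_one, one_mul]
  refine and_congr_right fun _ => exists_congr fun b => forall_congr' fun ξ => ?_
  rw [Lp.ext_iff]
  exact (coeFn_expLp (μ := volume.restrict F) (ξ : V)).congr_right.symm

theorem isSpectral_of_orthonormal {ι : Type*} [Countable ι] {γ : ι → V}
    (hγ : Orthonormal ℂ fun i => expLp (volume.restrict F) (γ i))
    (hspan : (Submodule.span ℂ (Set.range fun i => expLp (volume.restrict F) (γ i)))ᗮ = ⊥) :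
    IsSpectral F := by
  have hinj : γ.Injective := fun i j hij =>
    hγ.linearIndependent.injective (congrArg (expLp (volume.restrict F)) hij)
  let e := Equiv.ofInjective γ hinj
  have he : (fun ξ : Set.range γ => expLp (volume.restrict F) (ξ : V)) =
      (fun i => expLp (volume.restrict F) (γ i)) ∘ e.symm := by
    ext1 ξ
    rw [Function.comp_apply, Equiv.apply_ofInjective_symm hinj]
  refine ⟨Set.range γ, isSpectrum_iff.2 ⟨Set.countable_range γ,
    HilbertBasis.mkOfOrthogonalEqBot (v := fun ξ => expLp (volume.restrict F) (ξ : V)) ?_ ?_,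
    fun ξ => by rw [HilbertBasis.coe_mkOfOrthogonalEqBot]⟩⟩
  · rw [he]
    exact hγ.comp _ e.symm.injective
  · rwa [he, e.symm.surjective.range_comp]

end spectrum

section tensor

variable {α β : Type*} [MeasurableSpace α] [MeasurableSpace β] {μ : Measure α} {ν : Measure β}

theorem memLp_two_mul_prod {f : α → ℂ} {g : β → ℂ} (hf : MemLp f 2 μ) (hg : MemLp g 2 ν) :
    MemLp (fun z => f z.1 * g z.2) 2 (μ.prod ν) := by
  refine (memLp_two_iff_integrable_sq_norm (hf.1.comp_fst.mul hg.1.comp_snd)).2 ?_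
  refine (hf.integrable_norm_pow two_ne_zero).mul_prod (hg.integrable_norm_pow two_ne_zero)
    |>.congr (.of_forall fun z => ?_)
  simp [mul_pow]

/-- The elementary tensor `(x, y) ↦ f x * g y` in `L²(μ ⊗ ν)`. -/
noncomputable def tensorLp (f : Lp ℂ 2 μ) (g : Lp ℂ 2 ν) : Lp ℂ 2 (μ.prod ν) :=
  (memLp_two_mul_prod (Lp.memLp f) (Lp.memLp g)).toLp _

theorem coeFn_tensorLp (f : Lp ℂ 2 μ) (g : Lp ℂ 2 ν) :
    tensorLp f g =ᵐ[μ.prod ν] fun z => f z.1 * g z.2 := MemLp.coeFn_toLp _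

theorem inner_tensorLp [SFinite μ] [SFinite ν] (f f' : Lp ℂ 2 μ) (g g' : Lp ℂ 2 ν) :
    inner ℂ (tensorLp f g) (tensorLp f' g') = inner ℂ f f' * inner ℂ g g' := by
  rw [L2.inner_def, L2.inner_def, L2.inner_def, ← integral_prod_mul]
  refine integral_congr_ae ?_
  filter_upwards [coeFn_tensorLp f g, coeFn_tensorLp f' g'] with z hz hz'
  simp only [RCLike.inner_apply', hz, hz', map_mul]
  ring

end tensor

section product

variable {n : ℕ} {E : Set ℝ} {F : Set (EuclideanSpace ℝ (Fin n))}

theorem measurePreserving_ofLp_restrict_euclideanProd :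
    MeasurePreserving (WithLp.ofLp (p := 2) (V := ℝ × EuclideanSpace ℝ (Fin n)))
      (volume.restrict (euclideanProd E F)) ((volume.restrict E).prod (volume.restrict F)) := by
  rw [Measure.prod_restrict]
  exact (WithLp.volume_preserving_ofLp ℝ (EuclideanSpace ℝ (Fin n))).restrict_preimage_emb
    (MeasurableEquiv.toLp 2 (ℝ × EuclideanSpace ℝ (Fin n))).symm.measurableEmbedding (E ×ˢ F)

/-- The isometry `L²(E) ⊗ L²(F) → L²(E × F)` on elementary tensors. -/
noncomputable def euclideanTensorLp (f : Lp ℂ 2 (volume.restrict E))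
    (g : Lp ℂ 2 (volume.restrict F)) : Lp ℂ 2 (volume.restrict (euclideanProd E F)) :=
  Lp.compMeasurePreserving _ measurePreserving_ofLp_restrict_euclideanProd (tensorLp f g)

theorem inner_euclideanTensorLp (f f' : Lp ℂ 2 (volume.restrict E))
    (g g' : Lp ℂ 2 (volume.restrict F)) :
    inner ℂ (euclideanTensorLp f g) (euclideanTensorLp f' g') = inner ℂ f f' * inner ℂ g g' := by
  rw [← inner_tensorLp]
  exact (Lp.compMeasurePreservingₗᵢ (E := ℂ) (p := 2) ℂ _
    measurePreserving_ofLp_restrict_euclideanProd).inner_map_map _ _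

theorem expChar_prod (ξ z : WithLp 2 (ℝ × EuclideanSpace ℝ (Fin n))) :
    expChar ξ z = expChar ξ.fst z.fst * expChar ξ.snd z.snd := by
  have h : inner ℝ ξ z = inner ℝ ξ.fst z.fst + inner ℝ ξ.snd z.snd := WithLp.prod_inner_apply ξ z
  simp only [expChar, h, ← Complex.exp_add]
  push_cast
  ring_nf

variable [IsProbabilityMeasure (volume.restrict E)] [IsProbabilityMeasure (volume.restrict F)]

instance isProbabilityMeasure_restrict_euclideanProd :
    IsProbabilityMeasure (volume.restrict (euclideanProd E F)) :=
  ⟨by simpa using measurePreserving_ofLp_restrict_euclideanProd (E := E) (F := F)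
    |>.measure_preimage nullMeasurableSet_univ⟩

theorem expLp_euclideanProd (ξ : WithLp 2 (ℝ × EuclideanSpace ℝ (Fin n))) :
    expLp (volume.restrict (euclideanProd E F)) ξ =
      euclideanTensorLp (expLp (volume.restrict E) ξ.fst) (expLp (volume.restrict F) ξ.snd) := by
  have hmp := measurePreserving_ofLp_restrict_euclideanProd (E := E) (F := F)
  rw [Lp.ext_iff]
  filter_upwards [coeFn_expLp (μ := volume.restrict (euclideanProd E F)) ξ,
    Lp.coeFn_compMeasurePreserving
      (tensorLp (expLp (volume.restrict E) ξ.fst) (expLp (volume.restrict F) ξ.snd)) hmp,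
    hmp.quasiMeasurePreserving.ae (coeFn_tensorLp _ _),
    hmp.quasiMeasurePreserving.ae (Measure.quasiMeasurePreserving_fst.ae (coeFn_expLp ξ.fst)),
    hmp.quasiMeasurePreserving.ae (Measure.quasiMeasurePreserving_snd.ae (coeFn_expLp ξ.snd))]
    with z hξ hcomp htensor hfst hsnd
  rw [hξ, expChar_prod, euclideanTensorLp, hcomp, Function.comp_apply, htensor, hfst, hsnd]
  rfl

theorem IsSpectrum.reproducesVolumeOn {Λ : Set (WithLp 2 (ℝ × EuclideanSpace ℝ (Fin n)))}
    (hΛ : IsSpectrum (euclideanProd E F) Λ) (v : Lp ℂ 2 (volume.restrict F)) (s : ℝ) :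
    ReproducesVolumeOn (fun ξ : Λ => inner ℂ (expLp (volume.restrict F) ξ.1.snd) v)
      (fun ξ : Λ => ξ.1.fst - s) (‖v‖ ^ 2) E := by
  intro P Q hP hQ hPE hQE
  obtain ⟨-, b, hb⟩ := isSpectrum_iff.1 hΛ
  let f {P : Set ℝ} (hP : BddMeas P) : Lp ℂ 2 (volume.restrict (euclideanProd E F)) :=
    euclideanTensorLp (cutoffExpLp (volume.restrict E) s hP.measurableSet) v
  have hcoeff {P} (hP : BddMeas P) (hPE : P ≤ᵐ[volume] E) (ξ : Λ) : inner ℂ (b ξ) (f hP) =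
      inner ℂ (expLp (volume.restrict F) ξ.1.snd) v * setFourier P (ξ.1.fst - s) := by
    rw [hb, expLp_euclideanProd, inner_euclideanTensorLp, ← cutoffExpLp_univ,
      inner_cutoffExpLp_restrict _ _ (by rwa [Set.univ_inter]), Set.univ_inter, mul_comm]
  have hgram : inner ℂ (f hP) (f hQ) = ((‖v‖ ^ 2 * volume.real (P ∩ Q) : ℝ) : ℂ) := by
    rw [inner_euclideanTensorLp, inner_cutoffExpLp_restrict _ _
      (Set.inter_subset_left.eventuallyLE.trans hPE), inner_self_eq_norm_sq_to_K, sub_self]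
    simp [setFourier, expChar, mul_comm]
  rw [← hgram]
  refine (b.hasSum_inner_mul_inner (f hP) (f hQ)).congr_fun fun ξ => ?_
  rw [← hcoeff hP hPE, ← hcoeff hQ hQE, RCLike.inner_apply', inner_conj_symm]

end product

section unitInterval

theorem setFourier_Ico_one_zero : setFourier (Set.Ico 0 1) 0 = 1 := by
  simp [setFourier, expChar]

theorem exists_int_of_setFourier_Ico_one_eq_zero {η : ℝ} (h : setFourier (Set.Ico 0 1) η = 0) :
    ∃ k : ℤ, k ≠ 0 ∧ η = k := by
  have hη : η ≠ 0 := by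
    rintro rfl
    exact one_ne_zero (setFourier_Ico_one_zero.symm.trans h)
  have hz : -(2 * (Real.pi : ℂ) * Complex.I * η) ≠ 0 := by simp [Real.pi_ne_zero, hη]
  have hexp (x : ℝ) :
      expChar (-η) x = Complex.exp (-(2 * (Real.pi : ℂ) * Complex.I * η) * x) := by
    simp only [expChar, RCLike.inner_apply', conj_trivial]
    push_cast
    ring_nf
  simp_rw [setFourier, integral_Ico_eq_integral_Ioc,
    ← intervalIntegral.integral_of_le zero_le_one, hexp] at h
  rw [integral_exp_mul_complex hz, div_eq_zero_iff, or_iff_left hz, sub_eq_zero,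
    Complex.ofReal_one, mul_one, Complex.ofReal_zero, mul_zero, Complex.exp_zero] at h
  obtain ⟨k, hk⟩ := Complex.exp_eq_one_iff.1 h
  have hηk : η = ((-k : ℤ) : ℝ) := by
    rw [← Complex.ofReal_inj]
    apply mul_left_cancel₀ (by simp [Real.pi_ne_zero] : 2 * (Real.pi : ℂ) * Complex.I ≠ 0)
    push_cast
    linear_combination -hk
  refine ⟨-k, fun hk0 => hη ?_, hηk⟩
  rw [hηk, hk0, Int.cast_zero]

theorem setFourier_Ico_one_ne_zero {η : ℝ} (hη : |η| < 1) : setFourier (Set.Ico 0 1) η ≠ 0 := by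
  intro h
  obtain ⟨k, hk, rfl⟩ := exists_int_of_setFourier_Ico_one_eq_zero h
  exact hk (Int.abs_lt_one_iff.1 (by exact_mod_cast hη))

theorem ae_setFourier_Ico_one_ne_zero : ∀ᵐ η : ℝ, setFourier (Set.Ico 0 1) η ≠ 0 := by
  filter_upwards [(Set.countable_range ((↑) : ℤ → ℝ)).ae_notMem volume] with η hη h
  obtain ⟨k, -, rfl⟩ := exists_int_of_setFourier_Ico_one_eq_zero h
  exact hη ⟨k, rfl⟩

theorem measurable_setFourier (P : Set ℝ) : Measurable (setFourier P) := by
  have : Continuous (Function.uncurry fun ξ x : ℝ => expChar (-ξ) x) := by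
    unfold expChar Function.uncurry
    fun_prop
  exact (this.stronglyMeasurable.integral_prod_right (ν := volume.restrict P)).measurable

theorem fourierCoeffOn_expChar (s : ℝ) (k : ℤ) :
    fourierCoeffOn zero_lt_one (expChar (-s)) k = setFourier (Set.Ico 0 1) (s + k) := by
  rw [fourierCoeffOn_eq_integral, intervalIntegral.integral_of_le zero_le_one,
    ← integral_Ico_eq_integral_Ioc, setFourier, sub_zero, div_one, one_smul]
  refine setIntegral_congr_fun measurableSet_Ico fun x _ => ?_
  simp only [fourier_coe_apply, smul_eq_mul, neg_add, expChar_add_left]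
  rw [mul_comm]
  congr 1
  simp only [expChar, RCLike.inner_apply', conj_trivial]
  push_cast
  ring_nf

theorem hasSum_sq_setFourier_Ico_one_add_int (s : ℝ) :
    HasSum (fun k : ℤ => ‖setFourier (Set.Ico 0 1) (s + k)‖ ^ 2) 1 := by
  simpa [fourierCoeffOn_expChar, norm_expChar] using
    hasSum_sq_fourierCoeffOn (zero_lt_one (α := ℝ)) (memLp_expChar _ (-s))

theorem measurable_enorm_setFourier_sq (P : Set ℝ) : Measurable fun η => ‖setFourier P η‖ₑ ^ 2 :=
  (measurable_setFourier P).enorm.pow_const 2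

theorem lintegral_eq_lintegral_tsum_add_int {f : ℝ → ENNReal} (hf : Measurable f) :
    ∫⁻ x, f x = ∫⁻ x in Set.Ioc 0 1, ∑' k : ℤ, f (x + k) := by
  have hshift (k : ℤ) :
      ∫⁻ x in Set.Ioc (k : ℝ) (k + 1), f x = ∫⁻ x in Set.Ioc 0 1, f (x + k) := by
    rw [← (measurePreserving_add_right volume (k : ℝ)).setLIntegral_comp_preimage_emb
      (measurableEmbedding_addRight (k : ℝ)) f]
    simp
  have hmeas (k : ℤ) : Measurable fun x => f (x + k) := hf.comp (measurable_add_const _)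
  rw [lintegral_tsum fun k => (hmeas k).aemeasurable, ← setLIntegral_univ, ← iUnion_Ioc_intCast ℝ,
    lintegral_iUnion (fun k => measurableSet_Ioc) (Set.pairwise_disjoint_Ioc_intCast ℝ)]
  exact tsum_congr hshift

theorem lintegral_enorm_setFourier_Ico_one_sq :
    ∫⁻ η, ‖setFourier (Set.Ico 0 1) η‖ₑ ^ 2 = 1 := by
  have hsum (s : ℝ) : ∑' k : ℤ, ‖setFourier (Set.Ico 0 1) (s + k)‖ₑ ^ 2 = 1 := by
    have h := hasSum_sq_setFourier_Ico_one_add_int s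
    have hofReal := ENNReal.ofReal_tsum_of_nonneg (fun _ => sq_nonneg _) h.summable
    rw [h.tsum_eq, ENNReal.ofReal_one] at hofReal
    simp only [hofReal, ENNReal.ofReal_pow (norm_nonneg _), ofReal_norm]
  rw [lintegral_eq_lintegral_tsum_add_int (measurable_enorm_setFourier_sq _)]
  simp [hsum]

end unitInterval

section slab

theorem lintegral_mul_tsum_slab {ι : Type*} [Countable ι] {φ : ℝ → ENNReal} (hφ : Measurable φ)
    (t : ι → ℝ) (g : ι → ENNReal) :
    ∫⁻ a, φ a * ∑' i : {i // t i ∈ Set.Ico a (a + 1)}, g i =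
      ∫⁻ u in Set.Ico 0 1, ∑' i, g i * φ (t i - u) := by
  let f (i : ι) : ℝ → ENNReal := (Set.Ico 0 1).indicator fun u => g i * φ (t i - u)
  have hmeas (i : ι) : Measurable fun u => g i * φ (t i - u) :=
    (hφ.comp (measurable_const_sub _)).const_mul _
  have hf (i : ι) : Measurable fun a => f i (t i - a) :=
    ((hmeas i).indicator measurableSet_Ico).comp (measurable_const_sub _)
  have hterm (a : ℝ) (i : ι) :
      φ a * Set.indicator {i | t i ∈ Set.Ico a (a + 1)} g i = f i (t i - a) := by
    have hmem : t i - a ∈ Set.Ico 0 1 ↔ t i ∈ Set.Ico a (a + 1) := by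
      rw [Set.mem_Ico, Set.mem_Ico, sub_nonneg, sub_lt_iff_lt_add']
    simp only [f, Set.indicator, hmem, Set.mem_ofPred_eq, sub_sub_cancel, mul_ite, mul_zero,
      mul_comm]
  calc ∫⁻ a, φ a * ∑' i : {i // t i ∈ Set.Ico a (a + 1)}, g i
    _ = ∫⁻ a, ∑' i, f i (t i - a) := lintegral_congr fun a => by
      rw [← tsum_congr (hterm a), ENNReal.tsum_mul_left]
      exact congrArg _ (tsum_subtype {i | t i ∈ Set.Ico a (a + 1)} g)
    _ = ∑' i, ∫⁻ u, f i u := by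
      rw [lintegral_tsum fun i => (hf i).aemeasurable]
      exact tsum_congr fun i => lintegral_sub_left_eq_self (f i) (t i)
    _ = ∫⁻ u in Set.Ico 0 1, ∑' i, g i * φ (t i - u) := by
      rw [lintegral_tsum fun i => (hmeas i).aemeasurable]
      exact tsum_congr fun i => lintegral_indicator measurableSet_Ico _

variable {ι H : Type*} [NormedAddCommGroup H] [InnerProductSpace ℂ H] {e : ι → H}

theorem tsum_enorm_inner_sq_le (he : Orthonormal ℂ e) (v : H) :
    ∑' i, ‖inner ℂ (e i) v‖ₑ ^ 2 ≤ ‖v‖ₑ ^ 2 := by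
  refine ENNReal.summable.tsum_le_of_sum_le fun s => ?_
  have h := ENNReal.ofReal_le_ofReal (he.sum_inner_products_le v (s := s))
  rw [ENNReal.ofReal_sum_of_nonneg fun _ _ => sq_nonneg _] at h
  simpa only [ENNReal.ofReal_pow (norm_nonneg _), ofReal_norm] using h

theorem orthogonal_span_eq_bot_of_dense (he : Orthonormal ℂ e) {D : Set H} (hD : Dense D)
    (h : ∀ v ∈ D, ∑' i, ‖inner ℂ (e i) v‖ₑ ^ 2 = ‖v‖ₑ ^ 2) :
    (Submodule.span ℂ (Set.range e))ᗮ = ⊥ := by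
  refine (Submodule.eq_bot_iff _).2 fun v hv => ?_
  have hperp (i : ι) : inner ℂ (e i) v = 0 :=
    (Submodule.mem_orthogonal _ v).1 hv _ (Submodule.subset_span ⟨i, rfl⟩)
  have hle : ∀ u ∈ D, ‖u‖ ≤ ‖u - v‖ := fun u hu => by
    have hb := tsum_enorm_inner_sq_le he (u - v)
    simp only [inner_sub_right, hperp, sub_zero, h u hu] at hb
    rwa [ENNReal.pow_le_pow_left_iff two_ne_zero, enorm_le_iff_norm_le] at hb
  have hle' (u : H) : ‖u‖ ≤ ‖u - v‖ :=
    hD.induction hle (isClosed_le continuous_norm (continuous_id.sub continuous_const).norm) u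
  simpa using hle' v

variable {t : ι → ℝ}

/-- Parseval's identity for the tensors of an exponential on `[0, 1)` with a vector of `H`, with
respect to the tensors of the exponentials of frequencies `t i` with the vectors `e i`. -/
def UnitIntervalParseval (t : ι → ℝ) (e : ι → H) : Prop :=
  ∀ (v : H) (s : ℝ), HasSum
    (fun i => ‖inner ℂ (e i) v‖ ^ 2 * ‖setFourier (Set.Ico 0 1) (t i - s)‖ ^ 2) (‖v‖ ^ 2)

namespace UnitIntervalParseval

theorem tsum_enorm (h : UnitIntervalParseval t e) (v : H) (s : ℝ) :
    ∑' i, ‖inner ℂ (e i) v‖ₑ ^ 2 * ‖setFourier (Set.Ico 0 1) (t i - s)‖ₑ ^ 2 = ‖v‖ₑ ^ 2 := by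
  have hsum := h v s
  rw [← ofReal_norm, ← ENNReal.ofReal_pow (norm_nonneg _), ← hsum.tsum_eq,
    ENNReal.ofReal_tsum_of_nonneg (fun _ => by positivity) hsum.summable]
  simp only [ENNReal.ofReal_mul (sq_nonneg _), ENNReal.ofReal_pow (norm_nonneg _), ofReal_norm]

theorem inner_eq_zero (h : UnitIntervalParseval t e) (he : ∀ i, ‖e i‖ = 1) {i j : ι}
    (hij : i ≠ j) (ht : |t i - t j| < 1) : inner ℂ (e i) (e j) = 0 := by
  classical
  have hle := sum_le_hasSum {i, j} (fun _ _ => by positivity) (h (e j) (t j))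
  rw [Finset.sum_pair hij, sub_self, setFourier_Ico_one_zero, inner_self_eq_norm_sq_to_K,
    he] at hle
  have hprod : ‖inner ℂ (e i) (e j)‖ ^ 2 * ‖setFourier (Set.Ico 0 1) (t i - t j)‖ ^ 2 = 0 :=
    le_antisymm (by simpa using hle) (by positivity)
  simpa [setFourier_Ico_one_ne_zero ht] using hprod

theorem orthonormal_slab (h : UnitIntervalParseval t e) (he : ∀ i, ‖e i‖ = 1) (a : ℝ) :
    Orthonormal ℂ fun i : {i // t i ∈ Set.Ico a (a + 1)} => e i := by
  refine ⟨fun i => he i, fun i j hij => h.inner_eq_zero he (Subtype.coe_injective.ne hij) ?_⟩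
  rw [abs_lt]
  constructor <;> linarith [i.2.1, i.2.2, j.2.1, j.2.2]

theorem ae_tsum_slab_eq [Countable ι] (h : UnitIntervalParseval t e) (he : ∀ i, ‖e i‖ = 1)
    (v : H) :
    ∀ᵐ a : ℝ, ∑' i : {i // t i ∈ Set.Ico a (a + 1)}, ‖inner ℂ (e i) v‖ₑ ^ 2 = ‖v‖ₑ ^ 2 := by
  let φ (η : ℝ) : ENNReal := ‖setFourier (Set.Ico 0 1) η‖ₑ ^ 2
  have hφ : Measurable φ := measurable_enorm_setFourier_sq _
  have hint : ∫⁻ a, φ a * ∑' i : {i // t i ∈ Set.Ico a (a + 1)}, ‖inner ℂ (e i) v‖ₑ ^ 2 =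
      ‖v‖ₑ ^ 2 := by
    rw [lintegral_mul_tsum_slab hφ t fun i => ‖inner ℂ (e i) v‖ₑ ^ 2]
    simp [φ, h.tsum_enorm]
  have hint' : ∫⁻ a, φ a * ‖v‖ₑ ^ 2 = ‖v‖ₑ ^ 2 := by
    rw [lintegral_mul_const _ hφ, lintegral_enorm_setFourier_Ico_one_sq, one_mul]
  have hae := ae_eq_of_ae_le_of_lintegral_le
    (.of_forall fun a => mul_le_mul_right (tsum_enorm_inner_sq_le (h.orthonormal_slab he a) v) _)
    (by simp [hint]) (hφ.mul_const _).aemeasurable (hint'.trans hint.symm).le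
  filter_upwards [hae, ae_setFourier_Ico_one_ne_zero] with a ha hφa
  exact (ENNReal.mul_right_inj (by simp [φ, hφa]) (by simp [φ])).1 ha

theorem exists_slab [Countable ι] [TopologicalSpace.SeparableSpace H]
    (h : UnitIntervalParseval t e) (he : ∀ i, ‖e i‖ = 1) :
    ∃ a, Orthonormal ℂ (fun i : {i // t i ∈ Set.Ico a (a + 1)} => e i) ∧
      (Submodule.span ℂ (Set.range fun i : {i // t i ∈ Set.Ico a (a + 1)} => e i))ᗮ = ⊥ := by
  obtain ⟨D, hDc, hD⟩ := TopologicalSpace.exists_countable_dense H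
  obtain ⟨a, ha⟩ := ((ae_ball_iff hDc).2 fun v _ => h.ae_tsum_slab_eq he v).exists
  have horth := h.orthonormal_slab he a
  exact ⟨a, horth, orthogonal_span_eq_bot_of_dense horth hD ha⟩

end UnitIntervalParseval

end slab

theorem proposition3p3_general {n : ℕ} {E : Set ℝ} {F : Set (EuclideanSpace ℝ (Fin n))} {a b : ℝ}
    (hab : a < b) (hE_meas : NullMeasurableSet E volume) (hE_vol : volume E = 1)
    (hI : Set.Ioo a b ≤ᵐ[volume] E) (hdiff : ∀ x, |x| < 1 → volume {w | w ∈ E ∧ w + x ∈ E} ≠ 0)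
    (hF_vol : volume F = 1) (hEF : IsSpectral (euclideanProd E F)) : IsSpectral F := by
  have : IsProbabilityMeasure (volume.restrict E) := ⟨by simpa⟩
  have : IsProbabilityMeasure (volume.restrict F) := ⟨by simpa⟩
  have : Fact ((2 : ENNReal) ≠ ⊤) := ⟨by norm_num⟩
  obtain ⟨Λ, hΛ⟩ := hEF
  have : Countable Λ := hΛ.1.to_subtype
  have hI' : Set.Ico a (a + (b - a)) ≤ᵐ[volume] E := by
    rw [add_sub_cancel]
    exact Ioo_ae_eq_Ico.symm.le.trans hI
  have hparseval : UnitIntervalParseval (fun ξ : Λ => ξ.1.fst)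
      (fun ξ : Λ => expLp (volume.restrict F) ξ.1.snd) := fun v s =>
    (hΛ.reproducesVolumeOn v s).hasSum_sq_Ico_one hE_meas (sq_nonneg _) (sub_pos.2 hab) hI' hdiff
  obtain ⟨c, horth, hspan⟩ := hparseval.exists_slab fun ξ => norm_expLp ξ.1.snd
  exact isSpectral_of_orthonormal horth hspan

theorem proposition3p3 (n : ℕ) (E : Set ℝ) (F : Set (EuclideanSpace ℝ (Fin n))) (ε : ℝ)
    (hε : 0 < ε)
    (hE_meas : NullMeasurableSet E volume)
    (hE_sub : E ⊆ Set.Icc 0 (3 / 2 - ε))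
    (hE_vol : volume E = 1)
    (hE_tile : TilesRealBy E (Set.range ((↑) : ℤ → ℝ)))
    (hF_bdd : Bornology.IsBounded F)
    (hF_meas : NullMeasurableSet F volume)
    (hF_vol : volume F = 1)
    (hEF : IsSpectral (euclideanProd E F)) :
    IsSpectral F := by
  have hL : max 0 (1 / 2 - ε) < 1 / 2 := max_lt (by norm_num) (by linarith)
  have hE : E ⊆ Set.Icc 0 (1 + max 0 (1 / 2 - ε)) :=
    hE_sub.trans (Set.Icc_subset_Icc_right (by linarith [le_max_right 0 (1 / 2 - ε)]))
  exact proposition3p3_general (by linarith : max 0 (1 / 2 - ε) < 1) hE_meas hE_vol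
    (hE_tile.ae_mem_of_mem_Ioo (le_max_left _ _) (by linarith) hE)
    (fun _ => hE_tile.volume_mem_add_mem_ne_zero (le_max_left _ _) hL hE) hF_vol hEF
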